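/- **The space.** All spaces are real. Let $(m_j,n_j)_{j\ge 1}$ be natural numbers with $m_1\ge 4$, $m_{j+1}\ge m_j^2$, $n_1\ge m_1^2$, $n_{j+1}\ge (16n_j)^{\log_2 m_{j+1}}$; let $L\subset\mathbb N=\{1,2,\dots\}$ be infinite, let $l_1<l_2<\cdots$ be its elements, and put $m'_j=m_{l_j}$, $n'_j=n_{l_j}$ (so $m'_1=m_{\min L}$). Let $(X_k)_{k\ge1}$ be separable Banach spaces. The Argyros–Haydon sum $\mathcal Z=(\sum\oplus X_k)_{AH(L)}$ is built as follows. Recursively one defines pairwise disjoint finite sets $\Delta_1,\Delta_2,\dots$; put $\Gamma_n=\Delta_1\cup\dots\cup\Delta_n$, $\Gamma=\bigcup_n\Gamma_n$, and say that $\gamma\in\Delta_n$ has rank $n$. The set $\Delta_1$ is an arbitrary finite set. For $n\ge1$, $\Delta_{n+1}=\Delta_{n+1}^0\cup\Delta_{n+1}^1$, where: * $\Delta^0_{n+1}$ consists of the elements $(n+1,f)$, where $f=(f_k)_{k\le n}$ runs over a chosen finite family of elements of the unit ball of $(\sum_{k\le n}\oplus X_k^*)_1$; all these families together norm each $X_k$,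 i.e. $\|x\|$ is the supremum of $|f_k(x)|$ over the chosen $f$, for all $k$ and $x\in X_k$. * $\Delta_{n+1}^1$ consists of the elements of weight $m'_j$ with $1\le j\le n+1$, of two kinds: $(n+1,m'_j,p,b^*)$, of age $1$, with an admissible $0\le p<n$; and $(n+1,\xi,m'_j,p,b^*)$, where $\xi\in\Gamma_n$ has weight $m'_j$ and age $<n'_j$, with an admissible $p<n$, $p\ge \operatorname{rank}\xi$; its age is that of $\xi$ plus one. If $j$ is even, $b^*$ runs over $B_{p,n}$, a chosen finite $2^{-n}$-net, with rational coefficients, of the unit ball of $\ell_1(\Gamma_n\setminus\Gamma_p)$. If $j$ is odd, $b^*=e^*_\eta$ with $\eta\in\Gamma_n\setminus\Gamma_p$, where $\eta$ has weight $m'_{4i-2}>(n'_j)^2$ for some $i\ge 1$ in the first kind, and weight $m'_{4\sigma(\xi)}$ in the second kind. Here $\sigma:\Gamma\to\mathbb N$ is a chosen one-to-one coding function with $\sigma(\gamma)\ge\operatorname{rank}\gamma$. Which $p$ are admissible is a fixed choice, depending only on $r=\operatorname{rank}\xi$ ($r=0$ for the first kind), such that every admissible $p$ is $\ge r$ and $p=r$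 is admissible whenever $r<n$ (Argyros and Haydon admit only $p=r$). Let $\mathcal Z_\infty=\big(\sum_k\oplus(X_k\oplus\ell_\infty(\Delta_k))_\infty\big)_\infty$, and let $R_{[1,n]}$ be the restriction to the first $n$ coordinates. The linear extension operators $i_n:\big(\sum_{k\le n}\oplus(X_k\oplus\ell_\infty(\Delta_k))_\infty\big)_\infty\to\mathcal Z_\infty$ are determined by: $R_{[1,n]}i_n(u)=u$; all $X_k$-coordinates of $z=i_n(u)$ with $k>n$ vanish; and for $q\ge n$ and $\gamma\in\Delta_{q+1}$ the $\gamma$-coordinate of $z$ is $c^*_\gamma(z)$, where, with $P_{(p,q]}=i_qR_{[1,q]}-i_pR_{[1,p]}$, $$c_\gamma^*=0\ (\gamma\in\Delta_1),\qquad c^*_{(q+1,f)}(z)=\tfrac1{m_{\min L}}\sum_{k\le q}f_k(z_k),$$ $$c^*_{(q+1,m'_j,p,b^*)}=\tfrac1{m'_j}\,b^*\circ P_{(p,q]},\qquad c^*_{(q+1,\xi,m'_j,p,b^*)}=e^*_\xi+\tfrac1{m'_j}\,b^*\circ P_{(p,q]},$$ where $z_k$ is the $X_k$-coordinate of $z$.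 Finally $\mathcal Z$ is the closed linear span in $\mathcal Z_\infty$ of the ranges of the operators $i_n$, $n\ge1$. **Proposition.** Let $\mathcal Z=(\sum\oplus X_k)_{AH(L)}$ be as above, for any choices as described. Let $n\in\mathbb N$, let $T_k:X_k\to X_k$ ($1\le k\le n$) be bounded linear operators and $\lambda\in\mathbb R$. Let $j_k$ be the embedding of $X_k$ as the $X_k$-coordinate into $\big(\sum_{l\le k}\oplus(X_l\oplus\ell_\infty(\Delta_l))_\infty\big)_\infty$, let $\pi_k$ be the corresponding coordinate map, and let $P_{(n,\infty)}=I-i_nR_{[1,n]}$. Then $$T=\sum_{k=1}^n i_k\,j_k\,T_k\,\pi_k\,R_{[1,k]}+\lambda P_{(n,\infty)}$$ is a bounded linear operator $T:\mathcal Z\to\mathcal Z$, and there is a bounded finite-rank (hence compact) operator $K:\mathcal Z\to\mathcal Z$ with $$\|T-K\|\le\Big(1+\frac{4}{m_{\min L}-2}\Big)\max\Big\{\max_{1\le k\le n}\|T_k\|,\ |\lambda|\Big\}.$$ -/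

import Mathlib

open scoped ENNReal NNReal

/-- The lacunarity conditions on the parameters `(m_j, n_j)`, `j = 1, 2, …`, of the
Argyros–Haydon construction (the values at `j = 0` are irrelevant). -/
structure AHLacunary (m n : ℕ → ℕ) : Prop where
  four_le : 4 ≤ m 1
  sq_le : ∀ j, 1 ≤ j → m j ^ 2 ≤ m (j + 1)
  sq_le_n : m 1 ^ 2 ≤ n 1
  pow_le : ∀ j, 1 ≤ j → (16 * (n j : ℝ)) ^ Real.logb 2 (m (j + 1)) ≤ (n (j + 1) : ℝ)

/-- The tuples that serve as elements of `Γ = ⋃ Δ_n`. Elements of `Γ` are themselves labelled by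
natural numbers (the sets `Δ_n` are subsets of `ℕ`), so a tuple refers to earlier elements of `Γ`
through their labels; a finitely supported `b : ℕ →₀ ℚ` stands for the functional
`b* = ∑ b η • e*_η`.
* `base i`: the `i`-th element of `Δ_1`;
* `func n i`: the element `(n+1, f)` of `Δ⁰_{n+1}`, where `f` is the `i`-th chosen functional in
  the unit ball of `(∑_{k ≤ n} X_k*)_1`;
* `weighted n j a pred p b`: an element of `Δ¹_{n+1}` of weight `m_j` and age `a`, with
  predecessor `ξ` if `pred = some ξ` (none if `a = 1`), and with the functional `b*`
  acting after `P_{(p, n]}`. -/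
inductive AHNode : Type
  | base (i : ℕ)
  | func (n i : ℕ)
  | weighted (n j a : ℕ) (pred : Option ℕ) (p : ℕ) (b : ℕ →₀ ℚ)

namespace AHNode

/-- The `n` with `γ ∈ Δ_n`. -/
def rank : AHNode → ℕ
  | base _ => 1
  | func n _ => n + 1
  | weighted n _ _ _ _ _ => n + 1

/-- The index `j` of the weight `m_j`, for elements that have a weight. -/
def weight : AHNode → Option ℕ
  | weighted _ j _ _ _ _ => some j
  | _ => none

/-- The age of a weighted element. -/
def age : AHNode → ℕ
  | weighted _ _ a _ _ _ => a
  | _ => 0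

end AHNode

/-- The free choices in the construction of an Argyros–Haydon sum of `X 0, X 1, …`
(`X k` is the `(k+1)`-st space, so that the first `n` spaces are the `X k` with `k < n`).
* `label`: the identification of tuples with natural numbers;
* `card₁`: the number of elements of `Δ_1`;
* `card₀ n` and `fn n i`, `i < card₀ n`: the finitely many functionals `f = (f_k)_{k < n}`
  that are used for `Δ⁰_{n+1}`;
* `net p n`: the finite net `B_{p,n}` of the unit ball of `ℓ₁(Γ_n \ Γ_p)`;
* `code`: the coding function `σ`;
* `cut r p`: the interval `(p, n]` may be used for an element whose predecessor has rank `r`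
  (`r = 0`: no predecessor). The choice `cut r p ↔ p = r` is that of Argyros and Haydon,
  the choice `cut r p ↔ r ≤ p` is the most generous one. -/
structure AHChoices (X : ℕ → Type*) [∀ k, NormedAddCommGroup (X k)]
    [∀ k, NormedSpace ℝ (X k)] where
  label : ℕ ≃ AHNode
  card₁ : ℕ
  card₀ : ℕ → ℕ
  fn : ℕ → ℕ → ∀ k, X k →L[ℝ] ℝ
  net : ℕ → ℕ → Finset (ℕ →₀ ℚ)
  code : ℕ → ℕ
  cut : ℕ → ℕ → Prop

/-- The `j`-th term (`j = 1, 2, …`) of the subsequence `(s_i)_{i ∈ L}`. -/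
noncomputable def subseq (s : ℕ → ℕ) (L : Set ℕ) (j : ℕ) : ℕ :=
  s (Nat.nth (fun i => i ∈ L) (j - 1))

namespace AHChoices

variable {X : ℕ → Type*} [∀ k, NormedAddCommGroup (X k)] [∀ k, NormedSpace ℝ (X k)]

/-- The rank of the element with label `γ`. -/
def rank (D : AHChoices X) (γ : ℕ) : ℕ := (D.label γ).rank

/-- The weight index of the element with label `γ`. -/
def weight (D : AHChoices X) (γ : ℕ) : Option ℕ := (D.label γ).weight

/-- The age of the element with label `γ`. -/
def age (D : AHChoices X) (γ : ℕ) : ℕ := (D.label γ).age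

/-- The tuples that belong to `Δ_{n+1}`, when `G = Γ_n` is already known and the parameters are
`(m_j, n_j)_{j ∈ L}`. Even weights admit every `b* ∈ B_{p,n}`; odd weights admit only `e*_η`
with `η ∈ Γ_n \ Γ_p` of weight `m_{4i-2} > n_j²` (no predecessor) or of weight
`m_{4σ(ξ)}` (predecessor `ξ`). -/
def Allowed (D : AHChoices X) (m ν : ℕ → ℕ) (L : Set ℕ) (n : ℕ) (G : Set ℕ) : AHNode → Prop
  | .base i => n = 0 ∧ i < D.card₁
  | .func s i => s = n ∧ 1 ≤ n ∧ i < D.card₀ n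
  | .weighted s j a none p b =>
      s = n ∧ 1 ≤ j ∧ j ≤ n + 1 ∧ p < n ∧ a = 1 ∧ D.cut 0 p ∧
      ((Even j ∧ b ∈ D.net p n) ∨
       (Odd j ∧ ∃ η ∈ G, p < D.rank η ∧ b = Finsupp.single η 1 ∧
          ∃ i, 1 ≤ i ∧ D.weight η = some (4 * i - 2) ∧
            subseq ν L j ^ 2 < subseq m L (4 * i - 2)))
  | .weighted s j a (some ξ) p b =>
      s = n ∧ 1 ≤ j ∧ j ≤ n + 1 ∧ p < n ∧ ξ ∈ G ∧ D.weight ξ = some j ∧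
      D.age ξ < subseq ν L j ∧ a = D.age ξ + 1 ∧ D.cut (D.rank ξ) p ∧
      ((Even j ∧ b ∈ D.net p n) ∨
       (Odd j ∧ ∃ η ∈ G, p < D.rank η ∧ b = Finsupp.single η 1 ∧
          D.weight η = some (4 * D.code ξ)))

/-- `Γ_n = Δ_1 ∪ ⋯ ∪ Δ_n`. -/
def Gam (D : AHChoices X) (m ν : ℕ → ℕ) (L : Set ℕ) : ℕ → Set ℕ
  | 0 => ∅
  | n + 1 => Gam D m ν L n ∪ {γ | D.Allowed m ν L n (Gam D m ν L n) (D.label γ)}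

/-- `Γ = ⋃ Γ_n`. -/
def Gamma (D : AHChoices X) (m ν : ℕ → ℕ) (L : Set ℕ) : Set ℕ :=
  ⋃ n, D.Gam m ν L n

/-- The requirements on the choices: the functionals used for `Δ⁰_{n+1}` lie in the unit ball of
`(∑_{k ≤ n} X_k*)_1` and, all together, they norm every `X_k`; `B_{p,n}` is a finite `2⁻ⁿ`-net
of the unit ball of `ℓ₁(Γ_n \ Γ_p)`; the coding function is one-to-one on `Γ` and dominates
the rank; intervals start after the predecessor. -/
structure Admissible (D : AHChoices X) (m ν : ℕ → ℕ) (L : Set ℕ) : Prop where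
  fn_ball : ∀ n i, i < D.card₀ n → ∑ k ∈ Finset.range n, ‖D.fn n i k‖ ≤ 1
  fn_norming : ∀ k (x : X k), ∀ ε > 0, ∃ n, k < n ∧ ∃ i < D.card₀ n, ‖x‖ - ε < |D.fn n i k x|
  net_support : ∀ p n, p < n → ∀ b ∈ D.net p n, ∀ η ∈ b.support,
    η ∈ D.Gam m ν L n \ D.Gam m ν L p
  net_ball : ∀ p n, p < n → ∀ b ∈ D.net p n, ∑ η ∈ b.support, |b η| ≤ 1
  net_dense : ∀ p n, p < n → ∀ a : ℕ →₀ ℝ,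
    (∀ η ∈ a.support, η ∈ D.Gam m ν L n \ D.Gam m ν L p) → ∑ η ∈ a.support, |a η| ≤ 1 →
    ∃ b ∈ D.net p n, ∑ η ∈ a.support ∪ b.support, |a η - (b η : ℝ)| ≤ (1 / 2) ^ n
  code_injOn : Set.InjOn D.code (D.Gamma m ν L)
  rank_le_code : ∀ γ ∈ D.Gamma m ν L, D.rank γ ≤ D.code γ
  cut_self : ∀ r, D.cut r r
  le_of_cut : ∀ r p, D.cut r p → r ≤ p

/-- Formal vectors: one coordinate in each `X k` and one real coordinate for each label. -/
abbrev Vec (_D : AHChoices X) : Type _ := (∀ k, X k) × (ℕ → ℝ)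

/-- The functional `c*_γ` for `γ ∈ Δ_{s+1}`, evaluated at `z`, where `E p z` are the real
coordinates of `i_p (R_{[1,p]} z)`. It is `0` on `Δ_1`, it is `(1 / m_{min L}) f` on `Δ⁰_{s+1}`
and `e*_ξ + (1 / m_j) b* ∘ P_{(p,s]}` on `Δ¹_{s+1}`, without `e*_ξ` if there is no predecessor.
Since `b*` lives on `Γ_s`, one has `b* (P_{(p,s]} z) = b* (z - i_p (R_{[1,p]} z))`. -/
noncomputable def cStar (D : AHChoices X) (m : ℕ → ℕ) (L : Set ℕ)
    (E : ℕ → D.Vec → ℕ → ℝ) (γ : ℕ) (z : D.Vec) : ℝ :=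
  match D.label γ with
  | .base _ => 0
  | .func s i => (1 / (m (sInf L) : ℝ)) * ∑ k ∈ Finset.range s, D.fn s i k (z.1 k)
  | .weighted _ j _ pred p b =>
      pred.elim 0 z.2 +
        (1 / (subseq m L j : ℝ)) * ∑ η ∈ b.support, (b η : ℝ) * (z.2 η - E p z η)

open Classical in
/-- The first `n` coordinates in the spaces `X k`, followed by zeros. -/
noncomputable def trunc (n : ℕ) (x : ∀ k, X k) : ∀ k, X k := fun k => if k < n then x k else 0

open Classical in
/-- The real coordinates of `i_n (R_{[1,n]} z)` on `Γ_s ∪ Γ_n`, computed rank by rank: on `Γ_n`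
they are those of `z`, and for `γ ∈ Γ` of rank `s + 1 > n` the coordinate is the value of `c*_γ`
at the part constructed before. -/
noncomputable def extAux (D : AHChoices X) (m ν : ℕ → ℕ) (L : Set ℕ) :
    ℕ → ℕ → D.Vec → ℕ → ℝ
  | 0, n, z, γ => if γ ∈ D.Gam m ν L n then z.2 γ else 0
  | s + 1, n, z, γ =>
      if γ ∈ D.Gamma m ν L ∧ D.rank γ = s + 1 ∧ n < s + 1 then
        D.cStar m L (fun p w => extAux D m ν L s p w) γ
          (trunc n z.1, fun η => extAux D m ν L s n z η)
      else extAux D m ν L s n z γ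

/-- The vector `i_n (R_{[1,n]} z)`: the Bourgain–Delbaen extension of the first `n` coordinates
of `z`. -/
noncomputable def ext (D : AHChoices X) (m ν : ℕ → ℕ) (L : Set ℕ) (n : ℕ) (z : D.Vec) : D.Vec :=
  (trunc n z.1, fun γ => D.extAux m ν L (D.rank γ) n z γ)

/-- `Z_∞ = (∑ (X_k ⊕ ℓ_∞(Δ_k))_∞)_∞`, written as `(∑ X_k)_∞ ⊕_∞ ℓ_∞(Γ)`: both norms are the
supremum of the norms of all coordinates. -/
abbrev ZInfty (D : AHChoices X) (m ν : ℕ → ℕ) (L : Set ℕ) : Type _ :=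
  lp X ∞ × lp (fun _ : D.Gamma m ν L => ℝ) ∞

open Classical in
/-- The coordinates of an element of `Z_∞`. -/
noncomputable def coords (D : AHChoices X) (m ν : ℕ → ℕ) (L : Set ℕ) (z : D.ZInfty m ν L) :
    D.Vec :=
  (fun k => z.1 k, fun γ => if h : γ ∈ D.Gamma m ν L then z.2 ⟨γ, h⟩ else 0)

/-- `Y_n`, the range of `i_n` in `Z_∞`. -/
def Y (D : AHChoices X) (m ν : ℕ → ℕ) (L : Set ℕ) (n : ℕ) : Set (D.ZInfty m ν L) :=
  {z | ∃ u : D.Vec, D.coords m ν L z = D.ext m ν L n u}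

/-- The Argyros–Haydon sum `(∑ X_k)_{AH(L)}`: the closed linear span of `⋃ Y_n` in `Z_∞`. -/
noncomputable def space (D : AHChoices X) (m ν : ℕ → ℕ) (L : Set ℕ) :
    Submodule ℝ (D.ZInfty m ν L) :=
  (Submodule.span ℝ (⋃ n, D.Y m ν L n)).topologicalClosure

/-- The coordinates of `(T_1 ⊕ ⋯ ⊕ T_n) z + lam • P_{(n,∞)} z`, where `T_k` acts as
`i_k ∘ j_k ∘ T_k ∘ π_k ∘ R_{[1,k]}` and `P_{(n,∞)} = I - i_n ∘ R_{[1,n]}`. -/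
noncomputable def diag (D : AHChoices X) (m ν : ℕ → ℕ) (L : Set ℕ) (n : ℕ)
    (T : ∀ k : Fin n, X k →L[ℝ] X k) (lam : ℝ) (z : D.Vec) : D.Vec :=
  ∑ k : Fin n, D.ext m ν L (k + 1) (Pi.single (k : ℕ) (T k (z.1 k)), 0) +
    lam • (z - D.ext m ν L n z)

end AHChoices

/-!
Put `w = m (min L) > 2`. The coordinates of `i_n u` outside `Γ_n` are computed rank by rank, and
since every weight is at least `w`, a bound `B + (2 / w) C ≤ C` propagates: the extension of a
vector with spatial coordinates at most `A` and coordinates on `Γ_n` at most `B` has its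
`Γ`-coordinates bounded by `max (A / w) (w / (w - 2) * B)`. A vector with no coordinates in `Γ_n`
thus extends with the small bound `A / w`.

Let `A_k = T_k` for `k ≤ n` and `A_k = λ` otherwise. The operator
`U z = λ z + i_n (((A_k - λ) z_k)_k, 0)` has spatial coordinates `A_k z_k`, and its `Γ`-coordinates
differ from those of `λ z` by at most `2 max ‖A_k‖ ‖z‖ / w`. Finally `i_n R_{[1,n]}` fixes
`i_k u` for `k ≤ n`, so `T z - U z` is in the range of `i_n`, with no spatial coordinates up to `n`:
it is determined by its finitely many coordinates on `Γ_n`, and `K = T - U` has finite rank.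
-/

theorem isCompactOperator_of_finiteDimensional_range {𝕜 E F : Type*} [NontriviallyNormedField 𝕜]
    [LocallyCompactSpace 𝕜] [NormedAddCommGroup E] [NormedSpace 𝕜 E] [NormedAddCommGroup F]
    [NormedSpace 𝕜 F] (K : E →L[𝕜] F)
    [FiniteDimensional 𝕜 (LinearMap.range (K : E →ₗ[𝕜] F))] : IsCompactOperator K := by
  have : ProperSpace 𝕜 := .of_nontriviallyNormedField_of_weaklyLocallyCompactSpace 𝕜
  have : ProperSpace (LinearMap.range (K : E →ₗ[𝕜] F)) := FiniteDimensional.proper 𝕜 _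
  exact (isCompactOperator_of_locallyCompactSpace_dom K.rangeRestrict).clm_comp
    (LinearMap.range (K : E →ₗ[𝕜] F)).subtypeL

namespace AHLacunary

variable {m ν : ℕ → ℕ}

theorem four_le_of_one_le (h : AHLacunary m ν) {j : ℕ} (hj : 1 ≤ j) : 4 ≤ m j := by
  induction j, hj using Nat.le_induction with
  | base => exact h.four_le
  | succ j hj ih => nlinarith [h.sq_le j hj]

theorem monotoneOn (h : AHLacunary m ν) : MonotoneOn m (Set.Ici 1) := by
  intro i hi j _ hij
  induction j, hij using Nat.le_induction with
  | base => exact le_rfl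
  | succ j hij ih =>
    have hj : 1 ≤ j := le_trans hi hij
    exact (ih hj).trans ((Nat.le_self_pow two_ne_zero _).trans (h.sq_le j hj))

end AHLacunary

namespace AHChoices

section Trunc

variable {X : ℕ → Type*} [∀ k, NormedAddCommGroup (X k)]

theorem trunc_trunc (p n : ℕ) (x : ∀ k, X k) : trunc p (trunc n x) = trunc (min p n) x := by
  funext k
  simp only [trunc, lt_min_iff, ite_and]

theorem trunc_zero (n : ℕ) : trunc n (0 : ∀ k, X k) = 0 := by
  funext k
  simp [trunc]

theorem trunc_single {k n : ℕ} (hk : k < n) (x : X k) :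
    trunc n (Pi.single k x : ∀ k, X k) = Pi.single k x := by
  funext i
  rcases eq_or_ne i k with rfl | h
  · simp [trunc, hk]
  · simp [trunc, h]

theorem norm_trunc_le (n : ℕ) {x : ∀ k, X k} {A : ℝ} (hx : ∀ k, ‖x k‖ ≤ A) (k : ℕ) :
    ‖trunc n x k‖ ≤ A := by
  rw [trunc]
  split_ifs
  · exact hx k
  · simpa using (norm_nonneg _).trans (hx 0)

theorem isLinearMap_trunc [∀ k, NormedSpace ℝ (X k)] (n : ℕ) :
    IsLinearMap ℝ (trunc n : (∀ k, X k) → ∀ k, X k) where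
  map_add x y := by
    funext k
    by_cases h : k < n <;> simp [trunc, h]
  map_smul a x := by
    funext k
    by_cases h : k < n <;> simp [trunc, h]

end Trunc

variable {X : ℕ → Type*} [∀ k, NormedAddCommGroup (X k)] [∀ k, NormedSpace ℝ (X k)]
variable {D : AHChoices X} {m ν : ℕ → ℕ} {L : Set ℕ}

/-- The part of the conditions on the parameters and the choices that makes the extension operators
uniformly bounded: the smallest weight exceeds `2`, the functionals used in the construction have
norm at most one, and intervals start after the predecessor. -/
structure WeaklyAdmissible (D : AHChoices X) (m : ℕ → ℕ) (L : Set ℕ) : Prop where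
  infinite : L.Infinite
  two_lt : 2 < m (sInf L)
  le_weight : ∀ j ∈ L, m (sInf L) ≤ m j
  fn_ball : ∀ n i, i < D.card₀ n → ∑ k ∈ Finset.range n, ‖D.fn n i k‖ ≤ 1
  net_ball : ∀ p n, p < n → ∀ b ∈ D.net p n, ∑ η ∈ b.support, |b η| ≤ 1
  le_of_cut : ∀ r p, D.cut r p → r ≤ p

theorem Admissible.weaklyAdmissible (hD : D.Admissible m ν L) (hmν : AHLacunary m ν)
    (hL : L.Infinite) (hL1 : ∀ j ∈ L, 1 ≤ j) : D.WeaklyAdmissible m L where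
  infinite := hL
  two_lt := lt_of_lt_of_le (by norm_num) (hmν.four_le_of_one_le (hL1 _ (Nat.sInf_mem hL.nonempty)))
  le_weight j hj := hmν.monotoneOn (hL1 _ (Nat.sInf_mem hL.nonempty)) (hL1 j hj) (Nat.sInf_le hj)
  fn_ball := hD.fn_ball
  net_ball := hD.net_ball
  le_of_cut := hD.le_of_cut

theorem WeaklyAdmissible.le_subseq (hD : D.WeaklyAdmissible m L) (j : ℕ) :
    m (sInf L) ≤ subseq m L j :=
  hD.le_weight _ (Nat.nth_mem_of_infinite hD.infinite _)

theorem Allowed.rank_eq {n : ℕ} {G : Set ℕ} {x : AHNode} (h : D.Allowed m ν L n G x) :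
    x.rank = n + 1 := by
  cases x with
  | base i => simp [AHNode.rank, h.1]
  | func s i => simp [AHNode.rank, h.1]
  | weighted s j a pred p b => cases pred <;> simp [AHNode.rank, h.1]

theorem Allowed.of_weighted {n s j a p : ℕ} {G : Set ℕ} {pred : Option ℕ} {b : ℕ →₀ ℚ}
    (h : D.Allowed m ν L n G (.weighted s j a pred p b)) :
    s = n ∧ j ≤ n + 1 ∧ p < n ∧ a = pred.elim 0 D.age + 1 ∧
      (∀ ξ ∈ pred, ξ ∈ G ∧ D.cut (D.rank ξ) p) ∧
      (b ∈ D.net p n ∨ ∃ η ∈ G, b = Finsupp.single η 1) := by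
  cases pred with
  | none =>
    obtain ⟨hs, -, hj, hp, ha, -, hb⟩ := h
    refine ⟨hs, hj, hp, ha, by simp, hb.imp And.right ?_⟩
    rintro ⟨-, η, hη, -, rfl, -⟩
    exact ⟨η, hη, rfl⟩
  | some ξ =>
    obtain ⟨hs, -, hj, hp, hξ, -, -, ha, hcut, hb⟩ := h
    refine ⟨hs, hj, hp, ha, by simpa using ⟨hξ, hcut⟩, hb.imp And.right ?_⟩
    rintro ⟨-, η, hη, -, rfl, -⟩
    exact ⟨η, hη, rfl⟩

theorem finite_setOf_allowed {n : ℕ} {G : Set ℕ} (hG : G.Finite) :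
    {x | D.Allowed m ν L n G x}.Finite := by
  set funcs : Set (ℕ →₀ ℚ) :=
    (⋃ p ∈ Set.Iio n, (D.net p n : Set (ℕ →₀ ℚ))) ∪ (fun η => Finsupp.single η 1) '' G
  have hfuncs : funcs.Finite :=
    ((Set.finite_Iio n).biUnion fun p _ => (D.net p n).finite_toSet).union (hG.image _)
  let weightedNode (t : ℕ × Option ℕ × ℕ × (ℕ →₀ ℚ)) : AHNode :=
    .weighted n t.1 (t.2.1.elim 0 D.age + 1) t.2.1 t.2.2.1 t.2.2.2
  have hweighted : (weightedNode ''
      (Set.Iic (n + 1) ×ˢ insert none (some '' G) ×ˢ Set.Iio n ×ˢ funcs)).Finite :=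
    ((Set.finite_Iic _).prod
      (((hG.image _).insert _).prod ((Set.finite_Iio _).prod hfuncs))).image _
  refine ((((Set.finite_Iio D.card₁).image AHNode.base).union
    ((Set.finite_Iio (D.card₀ n)).image (AHNode.func n))).union hweighted).subset ?_
  rintro (i | ⟨s, i⟩ | ⟨s, j, a, pred, p, b⟩) hx
  · exact Or.inl (Or.inl ⟨i, hx.2, rfl⟩)
  · obtain ⟨rfl, -, hi⟩ := hx
    exact Or.inl (Or.inr ⟨i, hi, rfl⟩)
  · obtain ⟨rfl, hj, hp, rfl, hpred, hb⟩ := Allowed.of_weighted hx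
    refine Or.inr ⟨(j, pred, p, b), ⟨hj, ?_, hp, ?_⟩, rfl⟩
    · cases pred with
      | none => exact Or.inl rfl
      | some ξ => exact Or.inr ⟨ξ, (hpred ξ rfl).1, rfl⟩
    · exact hb.imp (Set.mem_biUnion (Set.mem_Iio.2 hp)) fun ⟨η, hη, h⟩ => ⟨η, hη, h.symm⟩

theorem finite_gam (n : ℕ) : (D.Gam m ν L n).Finite := by
  induction n with
  | zero => exact Set.finite_empty
  | succ n ih => exact ih.union ((finite_setOf_allowed ih).preimage D.label.injective.injOn)

theorem monotone_gam : Monotone (D.Gam m ν L) :=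
  monotone_nat_of_le_succ fun _ => Set.subset_union_left

theorem exists_allowed_of_mem_gam {γ N : ℕ} (h : γ ∈ D.Gam m ν L N) :
    ∃ s < N, D.rank γ = s + 1 ∧ D.Allowed m ν L s (D.Gam m ν L s) (D.label γ) := by
  induction N with
  | zero => exact h.elim
  | succ N ih =>
    rcases h with h | h
    · obtain ⟨s, hs, h⟩ := ih h
      exact ⟨s, hs.trans N.lt_succ_self, h⟩
    · exact ⟨N, N.lt_succ_self, Allowed.rank_eq h, h⟩

theorem allowed_of_mem_gamma {γ s : ℕ} (h : γ ∈ D.Gamma m ν L) (hs : D.rank γ = s + 1) :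
    D.Allowed m ν L s (D.Gam m ν L s) (D.label γ) := by
  obtain ⟨N, h⟩ := Set.mem_iUnion.1 h
  obtain ⟨t, -, ht, h⟩ := exists_allowed_of_mem_gam h
  obtain rfl : t = s := by omega
  exact h

theorem mem_gam_iff {γ N : ℕ} : γ ∈ D.Gam m ν L N ↔ γ ∈ D.Gamma m ν L ∧ D.rank γ ≤ N := by
  constructor
  · intro h
    obtain ⟨s, hs, hr, -⟩ := exists_allowed_of_mem_gam h
    exact ⟨Set.mem_iUnion.2 ⟨N, h⟩, by omega⟩
  · rintro ⟨h, hN⟩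
    obtain ⟨M, hM⟩ := Set.mem_iUnion.1 h
    obtain ⟨s, -, hr, hs⟩ := exists_allowed_of_mem_gam hM
    exact monotone_gam (show s + 1 ≤ N from hr ▸ hN) (Or.inr hs)

theorem extAux_congr {n : ℕ} {z w : D.Vec} (h1 : trunc n z.1 = trunc n w.1)
    (h2 : Set.EqOn z.2 w.2 (D.Gam m ν L n)) (s : ℕ) :
    D.extAux m ν L s n z = D.extAux m ν L s n w := by
  induction s with
  | zero =>
    funext γ
    simp only [extAux]
    split_ifs with h
    · exact h2 h
    · rfl
  | succ s ih =>
    funext γ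
    simp only [extAux, ih, h1]

theorem ext_congr {n : ℕ} {z w : D.Vec} (h1 : trunc n z.1 = trunc n w.1)
    (h2 : Set.EqOn z.2 w.2 (D.Gam m ν L n)) : D.ext m ν L n z = D.ext m ν L n w := by
  simp only [ext, h1, extAux_congr h1 h2]

theorem extAux_of_mem_gam {γ n : ℕ} (s : ℕ) (z : D.Vec) (h : γ ∈ D.Gam m ν L n) :
    D.extAux m ν L s n z γ = z.2 γ := by
  induction s with
  | zero => rw [extAux, if_pos h]
  | succ s ih =>
    have := (mem_gam_iff.1 h).2
    rw [extAux, if_neg (by omega), ih]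

theorem ext_of_mem_gam {γ n : ℕ} (z : D.Vec) (h : γ ∈ D.Gam m ν L n) :
    (D.ext m ν L n z).2 γ = z.2 γ :=
  extAux_of_mem_gam _ z h

theorem extAux_of_notMem_gam {γ n p : ℕ} (hnp : n ≤ p) (z : D.Vec) (h : γ ∉ D.Gam m ν L p) :
    D.extAux m ν L p n z γ = 0 := by
  suffices ∀ s ≤ p, D.extAux m ν L s n z γ = 0 from this p le_rfl
  intro s hs
  induction s with
  | zero => rw [extAux, if_neg fun hn => h (monotone_gam hnp hn)]
  | succ s ih =>
    rw [extAux, if_neg fun ⟨hγ, hr, _⟩ => h (mem_gam_iff.2 ⟨hγ, hr.trans_le hs⟩),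
      ih (by omega)]

theorem extAux_of_rank_le {γ s : ℕ} (h : D.rank γ ≤ s) (n : ℕ) (z : D.Vec) :
    D.extAux m ν L s n z γ = (D.ext m ν L n z).2 γ := by
  induction s, h using Nat.le_induction with
  | base => rfl
  | succ s hs ih => rw [extAux, if_neg (by omega), ih]

theorem ext_of_notMem_gamma {γ : ℕ} (n : ℕ) (z : D.Vec) (h : γ ∉ D.Gamma m ν L) :
    (D.ext m ν L n z).2 γ = 0 := by
  rw [← extAux_of_rank_le (le_max_left _ n),
    extAux_of_notMem_gam (le_max_right _ n) z fun h' => h (mem_gam_iff.1 h').1]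

theorem extAux_ext {n p s : ℕ} (hnp : n ≤ p) (hps : p ≤ s) (z : D.Vec) :
    D.extAux m ν L s p (D.ext m ν L n z) = D.extAux m ν L s n z := by
  have htrunc : trunc p (D.ext m ν L n z).1 = trunc n z.1 := by
    rw [ext, trunc_trunc, min_eq_right hnp]
  induction s, hps using Nat.le_induction with
  | base =>
    funext γ
    by_cases h : γ ∈ D.Gam m ν L p
    · rw [extAux_of_mem_gam p _ h, extAux_of_rank_le (mem_gam_iff.1 h).2]
    · rw [extAux_of_notMem_gam le_rfl _ h, extAux_of_notMem_gam hnp _ h]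
  | succ s hps ih =>
    funext γ
    simp only [extAux, ih, htrunc]
    split_ifs <;> first | rfl | grind

theorem extAux_mk_trunc_of_le {n p s : ℕ} (hnp : n ≤ p) (hps : p ≤ s) (z : D.Vec) :
    D.extAux m ν L s p (trunc n z.1, D.extAux m ν L s n z) = D.extAux m ν L s n z := by
  have hcoord : Set.EqOn (D.extAux m ν L s n z) (D.ext m ν L n z).2 (D.Gam m ν L p) :=
    fun γ hγ => extAux_of_rank_le ((mem_gam_iff.1 hγ).2.trans hps) n z
  exact (extAux_congr (z := (trunc n z.1, D.extAux m ν L s n z)) (w := D.ext m ν L n z)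
    rfl hcoord s).trans (extAux_ext hnp hps z)

theorem extAux_mk_trunc_of_ge {n p : ℕ} (hpn : p ≤ n) (s : ℕ) (z : D.Vec) :
    D.extAux m ν L s p (trunc n z.1, D.extAux m ν L s n z) = D.extAux m ν L s p z :=
  extAux_congr (by simp only [trunc_trunc, min_eq_left hpn])
    (fun _ hγ => extAux_of_mem_gam s z (monotone_gam hpn hγ)) s

theorem ext_ext {n p : ℕ} (hnp : n ≤ p) (z : D.Vec) :
    D.ext m ν L p (D.ext m ν L n z) = D.ext m ν L n z := by
  refine Prod.ext (by simp only [ext, trunc_trunc, min_eq_right hnp]) (funext fun γ => ?_)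
  rw [← extAux_of_rank_le (le_max_left _ p), extAux_ext hnp (le_max_right _ p),
    extAux_of_rank_le (le_max_left _ p)]

theorem isLinearMap_cStar {E : ℕ → D.Vec → ℕ → ℝ} (hE : ∀ p, IsLinearMap ℝ (E p)) (γ : ℕ) :
    IsLinearMap ℝ (D.cStar m L E γ) := by
  rcases hγ : D.label γ with i | ⟨s, i⟩ | ⟨s, j, a, pred, p, b⟩
  · constructor <;> simp [cStar, hγ]
  · constructor
    · simp [cStar, hγ, Finset.sum_add_distrib, mul_add]
    · intro c z
      simp only [cStar, hγ, Prod.smul_fst, Pi.smul_apply, map_smul, smul_eq_mul,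
        ← Finset.mul_sum]
      ring
  · constructor
    · intro z w
      have hpred : pred.elim 0 (z.2 + w.2) = pred.elim 0 z.2 + pred.elim 0 w.2 := by
        cases pred <;> simp
      simp only [cStar, hγ, Prod.snd_add, hpred, (hE p).map_add, Pi.add_apply,
        add_sub_add_comm, mul_add, Finset.sum_add_distrib]
      ring
    · intro c z
      have hpred : pred.elim 0 (c • z.2) = c * pred.elim 0 z.2 := by
        cases pred <;> simp
      simp only [cStar, hγ, Prod.smul_snd, hpred, (hE p).map_smul, Pi.smul_apply, smul_eq_mul,
        ← mul_sub, mul_left_comm _ c, ← Finset.mul_sum]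
      ring

theorem isLinearMap_extAux (s n : ℕ) : IsLinearMap ℝ (D.extAux m ν L s n) := by
  induction s generalizing n with
  | zero => constructor <;> intros <;> funext γ <;> by_cases h : γ ∈ D.Gam m ν L n <;>
      simp [extAux, h]
  | succ s ih =>
    have hc := isLinearMap_cStar (m := m) (L := L) (fun p => ih p)
    constructor
    · intro z w
      funext γ
      simp only [extAux, Pi.add_apply, Prod.fst_add, (isLinearMap_trunc n).map_add, (ih n).map_add]
      split_ifs
      · exact (hc γ).map_add (trunc n z.1, _) (trunc n w.1, _)
      · rfl
    · intro c z
      funext γ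
      simp only [extAux, Pi.smul_apply, Prod.smul_fst, (isLinearMap_trunc n).map_smul,
        (ih n).map_smul]
      split_ifs
      · exact (hc γ).map_smul c (trunc n z.1, _)
      · rfl

variable (D m ν L) in
/-- The operator `i_n ∘ R_{[1,n]}` on formal vectors, as a linear map. -/
noncomputable def extL (n : ℕ) : D.Vec →ₗ[ℝ] D.Vec where
  toFun := D.ext m ν L n
  map_add' z w := Prod.ext ((isLinearMap_trunc n).map_add z.1 w.1)
    (funext fun γ => congrFun ((isLinearMap_extAux _ n).map_add z w) γ)
  map_smul' c z := Prod.ext ((isLinearMap_trunc n).map_smul c z.1)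
    (funext fun γ => congrFun ((isLinearMap_extAux _ n).map_smul c z) γ)

@[simp] theorem extL_apply (n : ℕ) (z : D.Vec) : extL D m ν L n z = D.ext m ν L n z := rfl

theorem ext_zero (n : ℕ) : D.ext m ν L n 0 = 0 :=
  map_zero (extL D m ν L n)

theorem ext_eq_zero {n : ℕ} {u : D.Vec} (h1 : trunc n u.1 = 0)
    (h2 : ∀ γ ∈ D.Gam m ν L n, u.2 γ = 0) : D.ext m ν L n u = 0 :=
  (ext_congr (w := 0) (h1.trans (trunc_zero n).symm) h2).trans (ext_zero n)

theorem norm_sum_le_of_weights {ι E : Type*} [SeminormedAddCommGroup E] {s : Finset ι}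
    {g : ι → E} {c : ι → ℝ} {A : ℝ} (hA : 0 ≤ A) (hc : ∑ i ∈ s, c i ≤ 1)
    (hg : ∀ i ∈ s, ‖g i‖ ≤ c i * A) : ‖∑ i ∈ s, g i‖ ≤ A :=
  calc ‖∑ i ∈ s, g i‖ ≤ ∑ i ∈ s, c i * A := norm_sum_le_of_le s hg
    _ = (∑ i ∈ s, c i) * A := (Finset.sum_mul _ _ _).symm
    _ ≤ A := mul_le_of_le_one_left hA hc

theorem abs_add_div_mul_sum_le {ι : Type*} {s : Finset ι} {c f : ι → ℝ} {x B C w₀ w : ℝ}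
    (hw₀ : 0 < w₀) (hw : w₀ ≤ w) (hC : 0 ≤ C) (hc : ∑ i ∈ s, |c i| ≤ 1) (hx : |x| ≤ B)
    (hf : ∀ i ∈ s, |f i| ≤ C) : |x + 1 / w * ∑ i ∈ s, c i * f i| ≤ B + C / w₀ := by
  have hsum : |∑ i ∈ s, c i * f i| ≤ C :=
    norm_sum_le_of_weights hC hc fun i hi => by
      rw [Real.norm_eq_abs, abs_mul]
      exact mul_le_mul_of_nonneg_left (hf i hi) (abs_nonneg _)
  calc |x + 1 / w * ∑ i ∈ s, c i * f i| ≤ |x| + |∑ i ∈ s, c i * f i| / w := by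
        refine (abs_add_le _ _).trans_eq ?_
        rw [one_div_mul_eq_div, abs_div, abs_of_pos (hw₀.trans_le hw)]
    _ ≤ B + C / w₀ := by gcongr

namespace WeaklyAdmissible

theorem sum_abs_le_one (hD : D.WeaklyAdmissible m L) {n p : ℕ} {b : ℕ →₀ ℚ} {G : Set ℕ}
    (hp : p < n) (hb : b ∈ D.net p n ∨ ∃ η ∈ G, b = Finsupp.single η 1) :
    ∑ η ∈ b.support, |(b η : ℝ)| ≤ 1 := by
  rcases hb with hb | ⟨η, -, rfl⟩
  · exact_mod_cast hD.net_ball p n hp b hb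
  · simp [Finsupp.support_single]

/-- The alternative in `hE` reflects the two cases of `i_p z` for `z = i_n u`: it is `z` if `n ≤ p`,
while for `p < n` the predecessor has its coordinate among those of `u`. -/
theorem abs_cStar_le (hD : D.WeaklyAdmissible m L) {A B C : ℝ} (hB : 0 ≤ B)
    (hAC : A / m (sInf L) ≤ C) (hBC : B + 2 / m (sInf L) * C ≤ C)
    {E : ℕ → D.Vec → ℕ → ℝ} {γ s : ℕ} (hγ : γ ∈ D.Gamma m ν L) (hs : D.rank γ = s + 1)
    {z : D.Vec} (h1 : ∀ k, ‖z.1 k‖ ≤ A) (h2 : ∀ η, |z.2 η| ≤ C)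
    (hE : ∀ p < s, E p z = z.2 ∨ (∀ ξ ∈ D.Gam m ν L p, |z.2 ξ| ≤ B) ∧ ∀ η, |E p z η| ≤ C) :
    |D.cStar m L E γ z| ≤ C := by
  have hC : 0 ≤ C := (abs_nonneg _).trans (h2 0)
  have hA : 0 ≤ A := (norm_nonneg _).trans (h1 0)
  have hm : 0 < (m (sInf L) : ℝ) := by exact_mod_cast (Nat.zero_lt_two.trans hD.two_lt)
  have hallowed := allowed_of_mem_gamma hγ hs
  rcases hlabel : D.label γ with i | ⟨t, i⟩ | ⟨t, j, a, pred, p, b⟩ <;>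
    simp only [cStar, hlabel] <;> rw [hlabel] at hallowed
  · simpa using hC
  · obtain ⟨rfl, -, hi⟩ := hallowed
    have hsum : |∑ k ∈ Finset.range t, D.fn t i k (z.1 k)| ≤ A := by
      rw [← Real.norm_eq_abs]
      exact norm_sum_le_of_weights hA (hD.fn_ball t i hi) fun k _ =>
        (D.fn t i k).le_opNorm_of_le (h1 k)
    rw [one_div_mul_eq_div, abs_div, abs_of_pos hm]
    exact (div_le_div_of_nonneg_right hsum hm.le).trans hAC
  · obtain ⟨rfl, -, hp, -, hpred, hb⟩ := Allowed.of_weighted hallowed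
    rcases hE p hp with hE | ⟨hpB, hEC⟩
    · cases pred <;> simp [hE, hC, h2]
    · have hpredB : |pred.elim 0 z.2| ≤ B := by
        cases pred with
        | none => simpa using hB
        | some ξ =>
          obtain ⟨hξ, hcut⟩ := hpred ξ rfl
          exact hpB ξ (mem_gam_iff.2 ⟨(mem_gam_iff.1 hξ).1, hD.le_of_cut _ _ hcut⟩)
      have hweight : (m (sInf L) : ℝ) ≤ subseq m L j := by exact_mod_cast hD.le_subseq j
      have hdiff (η : ℕ) : |z.2 η - E p z η| ≤ 2 * C := by
        linarith [abs_sub (z.2 η) (E p z η), h2 η, hEC η]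
      refine (abs_add_div_mul_sum_le hm hweight (by positivity) (hD.sum_abs_le_one hp hb) hpredB
        fun η _ => hdiff η).trans ?_
      rwa [mul_div_right_comm]

theorem abs_extAux_le (hD : D.WeaklyAdmissible m L) {A B C : ℝ} (hB : 0 ≤ B)
    (hAC : A / m (sInf L) ≤ C) (hBC : B + 2 / m (sInf L) * C ≤ C) {n : ℕ} {z : D.Vec}
    (h1 : ∀ k, ‖z.1 k‖ ≤ A) (h2 : ∀ γ ∈ D.Gam m ν L n, |z.2 γ| ≤ B) (s γ : ℕ) :
    |D.extAux m ν L s n z γ| ≤ C := by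
  have hA : 0 ≤ A := (norm_nonneg _).trans (h1 0)
  have hC : 0 ≤ C := (div_nonneg hA (Nat.cast_nonneg _)).trans hAC
  have hB_le : B ≤ C := by
    have : 0 ≤ 2 / (m (sInf L) : ℝ) * C := by positivity
    linarith
  induction s generalizing n γ with
  | zero =>
    rw [extAux]
    split_ifs with h
    · exact (h2 γ h).trans hB_le
    · simpa using hC
  | succ s ih =>
    rw [extAux]
    split_ifs with h
    swap
    · exact ih h2 γ
    obtain ⟨hγ, hs, -⟩ := h
    refine hD.abs_cStar_le hB hAC hBC hγ hs (norm_trunc_le n h1) (ih h2) fun p hp => ?_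
    rcases le_or_gt n p with hnp | hpn
    · exact Or.inl (extAux_mk_trunc_of_le hnp hp.le z)
    · have h2p : ∀ ξ ∈ D.Gam m ν L p, |z.2 ξ| ≤ B := fun ξ hξ => h2 ξ (monotone_gam hpn.le hξ)
      refine Or.inr ⟨fun ξ hξ => ?_, fun η => ?_⟩
      · exact (congrArg _ (extAux_of_mem_gam s z (monotone_gam hpn.le hξ))).trans_le (h2p ξ hξ)
      · exact (congrArg _ (congrFun (extAux_mk_trunc_of_ge hpn.le s z) η)).trans_le (ih h2p η)

theorem abs_ext_le (hD : D.WeaklyAdmissible m L) {A B : ℝ} (hB : 0 ≤ B) {n : ℕ} {z : D.Vec}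
    (h1 : ∀ k, ‖z.1 k‖ ≤ A) (h2 : ∀ γ ∈ D.Gam m ν L n, |z.2 γ| ≤ B) (γ : ℕ) :
    |(D.ext m ν L n z).2 γ| ≤ max (A / m (sInf L)) (m (sInf L) / (m (sInf L) - 2) * B) := by
  have hm : (2 : ℝ) < m (sInf L) := by exact_mod_cast hD.two_lt
  refine hD.abs_extAux_le hB (le_max_left _ _) ?_ h1 h2 _ γ
  set C := max (A / m (sInf L)) (m (sInf L) / (m (sInf L) - 2) * B)
  have hBC : m (sInf L) / (m (sInf L) - 2) * B ≤ C := le_max_right _ _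
  rw [div_mul_eq_mul_div, div_le_iff₀ (by linarith)] at hBC
  field_simp
  linarith

end WeaklyAdmissible

/-- The supremum norm of the coordinates of a formal vector is at most `R`. -/
def BoundedBy (v : D.Vec) (R : ℝ) : Prop :=
  (∀ k, ‖v.1 k‖ ≤ R) ∧ ∀ γ, |v.2 γ| ≤ R

theorem BoundedBy.nonneg {v : D.Vec} {R : ℝ} (hv : BoundedBy v R) : 0 ≤ R :=
  (abs_nonneg _).trans (hv.2 0)

theorem WeaklyAdmissible.boundedBy_ext (hD : D.WeaklyAdmissible m L) {v : D.Vec} {R : ℝ}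
    (hv : BoundedBy v R) (n : ℕ) :
    BoundedBy (D.ext m ν L n v) (m (sInf L) / (m (sInf L) - 2) * R) := by
  have hm : (2 : ℝ) < m (sInf L) := by exact_mod_cast hD.two_lt
  have hR := hv.nonneg
  have hR_le : R ≤ m (sInf L) / (m (sInf L) - 2) * R :=
    le_mul_of_one_le_left hR ((one_le_div (by linarith)).2 (by linarith))
  have hdiv : R / m (sInf L) ≤ R := div_le_self hR (by linarith)
  exact ⟨norm_trunc_le n fun k => (hv.1 k).trans hR_le, fun γ =>
    (hD.abs_ext_le hR hv.1 (fun γ _ => hv.2 γ) γ).trans (max_le (hdiv.trans hR_le) le_rfl)⟩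

theorem coords_injective : Function.Injective (D.coords m ν L) := by
  intro z w h
  refine Prod.ext (lp.ext (congrArg Prod.fst h)) (lp.ext (funext fun γ => ?_))
  simpa [coords] using congrFun (congrArg Prod.snd h) γ

theorem boundedBy_coords (z : D.ZInfty m ν L) : BoundedBy (D.coords m ν L z) ‖z‖ := by
  refine ⟨fun k => (lp.norm_apply_le_norm ENNReal.top_ne_zero z.1 k).trans (norm_fst_le z),
    fun γ => ?_⟩
  by_cases h : γ ∈ D.Gamma m ν L
  · simp only [coords, h, dif_pos]
    exact (lp.norm_apply_le_norm ENNReal.top_ne_zero z.2 ⟨γ, h⟩).trans (norm_snd_le z)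
  · simp [coords, h]

theorem norm_le_of_boundedBy_coords {z : D.ZInfty m ν L} {R : ℝ}
    (h : BoundedBy (D.coords m ν L z) R) : ‖z‖ ≤ R :=
  max_le (lp.norm_le_of_forall_le h.nonneg h.1)
    (lp.norm_le_of_forall_le h.nonneg fun γ => by simpa [coords] using h.2 γ)

theorem exists_coords_eq {v : D.Vec} {R : ℝ} (hv : BoundedBy v R)
    (hzero : ∀ γ ∉ D.Gamma m ν L, v.2 γ = 0) : ∃ z, D.coords m ν L z = v := by
  refine ⟨(⟨v.1, memℓp_infty ⟨R, ?_⟩⟩, ⟨fun γ => v.2 γ, memℓp_infty ⟨R, ?_⟩⟩), ?_⟩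
  · rintro _ ⟨k, rfl⟩
    exact hv.1 k
  · rintro _ ⟨γ, rfl⟩
    exact hv.2 γ
  · refine Prod.ext rfl (funext fun γ => ?_)
    by_cases h : γ ∈ D.Gamma m ν L
    · simp [coords, h]
    · simp [coords, h, hzero γ h]

variable (D m ν L) in
/-- The coordinates of an element of the Argyros–Haydon sum, as a linear map. -/
noncomputable def coordsL : D.space m ν L →ₗ[ℝ] D.Vec where
  toFun z := D.coords m ν L z
  map_add' z w := Prod.ext rfl <| funext fun γ => by
    by_cases h : γ ∈ D.Gamma m ν L <;> simp [coords, h]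
  map_smul' a z := Prod.ext rfl <| funext fun γ => by
    by_cases h : γ ∈ D.Gamma m ν L <;> simp [coords, h]

theorem coordsL_apply (z : D.space m ν L) : coordsL D m ν L z = D.coords m ν L z := rfl

theorem coordsL_injective : Function.Injective (coordsL D m ν L) :=
  coords_injective.comp Subtype.val_injective

theorem boundedBy_coordsL (z : D.space m ν L) : BoundedBy (coordsL D m ν L z) ‖z‖ :=
  boundedBy_coords (z : D.ZInfty m ν L)

theorem norm_le_of_boundedBy_coordsL {z : D.space m ν L} {R : ℝ}
    (h : BoundedBy (coordsL D m ν L z) R) : ‖z‖ ≤ R :=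
  norm_le_of_boundedBy_coords h

theorem WeaklyAdmissible.exists_mem_space_coordsL_eq_ext (hD : D.WeaklyAdmissible m L) (n : ℕ)
    {v : D.Vec} {R : ℝ} (hv : BoundedBy v R) :
    ∃ y, coordsL D m ν L y = extL D m ν L n v := by
  obtain ⟨y, hy⟩ := exists_coords_eq (hD.boundedBy_ext hv n) fun _ => ext_of_notMem_gamma n v
  exact ⟨⟨y, Submodule.le_topologicalClosure _
    (Submodule.subset_span (Set.mem_iUnion.2 ⟨n, v, hy⟩))⟩, hy⟩

theorem WeaklyAdmissible.exists_clm_coordsL_eq_ext (hD : D.WeaklyAdmissible m L) (n : ℕ)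
    (Ψ : D.Vec →ₗ[ℝ] D.Vec) {C : ℝ}
    (hΨ : ∀ z : D.space m ν L, BoundedBy (Ψ (coordsL D m ν L z)) (C * ‖z‖)) :
    ∃ J : D.space m ν L →L[ℝ] D.space m ν L,
      ∀ z, coordsL D m ν L (J z) = extL D m ν L n (Ψ (coordsL D m ν L z)) := by
  choose J hJ using fun z => hD.exists_mem_space_coordsL_eq_ext n (hΨ z)
  let Jlin : D.space m ν L →ₗ[ℝ] D.space m ν L :=
    { toFun := J
      map_add' := fun z w => coordsL_injective (by simp only [map_add, hJ])
      map_smul' := fun a z => coordsL_injective (by simp only [map_smul, hJ, RingHom.id_apply]) }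
  refine ⟨Jlin.mkContinuous (m (sInf L) / (m (sInf L) - 2) * C) fun z => ?_, hJ⟩
  have hbound : BoundedBy (coordsL D m ν L (J z)) (m (sInf L) / (m (sInf L) - 2) * C * ‖z‖) := by
    rw [hJ, mul_assoc]
    exact hD.boundedBy_ext (hΨ z) n
  exact norm_le_of_boundedBy_coordsL hbound

/-- The operator `A_1 ⊕ A_2 ⊕ ⋯` on the coordinates in the spaces `X k`, followed by the projection
that deletes the real coordinates. -/
noncomputable def diagonal (D : AHChoices X) (A : ∀ k, X k →L[ℝ] X k) : D.Vec →ₗ[ℝ] D.Vec :=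
  .inl ℝ _ _ ∘ₗ .piMap (fun k => (A k : X k →ₗ[ℝ] X k)) ∘ₗ .fst ℝ _ _

@[simp] theorem diagonal_apply (A : ∀ k, X k →L[ℝ] X k) (v : D.Vec) :
    D.diagonal A v = (fun k => A k (v.1 k), 0) := rfl

theorem diagonal_single {k : ℕ} (A : X k →L[ℝ] X k) (v : D.Vec) :
    D.diagonal (Pi.single k A) v = (Pi.single k (A (v.1 k)), 0) := by
  refine Prod.ext (funext fun i => ?_) rfl
  rcases eq_or_ne i k with rfl | h
  · simp
  · simp [h]

theorem boundedBy_diagonal {A : ∀ k, X k →L[ℝ] X k} {C R : ℝ} (hA : ∀ k, ‖A k‖ ≤ C) {v : D.Vec}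
    (hv : BoundedBy v R) : BoundedBy (D.diagonal A v) (C * R) := by
  refine ⟨fun k => (A k).le_of_opNorm_le_of_le (hA k) (hv.1 k), fun γ => ?_⟩
  simpa using mul_nonneg ((norm_nonneg _).trans (hA 0)) hv.nonneg

theorem norm_single_le {k : ℕ} (A : X k →L[ℝ] X k) (i : ℕ) :
    ‖(Pi.single k A : ∀ i, X i →L[ℝ] X i) i‖ ≤ ‖A‖ := by
  rcases eq_or_ne i k with rfl | h
  · simp
  · simp [h]

theorem WeaklyAdmissible.exists_clm_coords_eq_diag (hD : D.WeaklyAdmissible m L) (n : ℕ)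
    (T : ∀ k : Fin n, X k →L[ℝ] X k) (lam : ℝ) :
    ∃ S : D.space m ν L →L[ℝ] D.space m ν L,
      ∀ z : D.space m ν L, D.coords m ν L (S z) = D.diag m ν L n T lam (D.coords m ν L z) := by
  choose A hA using fun k : Fin n => hD.exists_clm_coordsL_eq_ext (ν := ν) (k + 1)
    (D.diagonal (Pi.single (k : ℕ) (T k)))
    fun z => boundedBy_diagonal (norm_single_le (T k)) (boundedBy_coordsL z)
  obtain ⟨J, hJ⟩ := hD.exists_clm_coordsL_eq_ext (ν := ν) n LinearMap.id (C := 1)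
    fun z => by
      rw [one_mul]
      exact boundedBy_coordsL z
  refine ⟨∑ k, A k + lam • (.id ℝ _ - J), fun z => ?_⟩
  rw [← coordsL_apply]
  simp only [add_apply, sum_apply, smul_apply, sub_apply, ContinuousLinearMap.id_apply, map_add,
    map_sum, map_smul, map_sub, hA, hJ, diagonal_single, LinearMap.id_apply]
  rfl

/-- The summands of `(T_1 - λ) ⊕ ⋯ ⊕ (T_n - λ) ⊕ 0 ⊕ 0 ⊕ ⋯`. -/
noncomputable def subScalar {n : ℕ} (T : ∀ k : Fin n, X k →L[ℝ] X k) (lam : ℝ) (k : ℕ) :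
    X k →L[ℝ] X k :=
  if h : k < n then T ⟨k, h⟩ - lam • .id ℝ (X k) else 0

theorem subScalar_of_lt {n k : ℕ} (h : k < n) (T : ∀ k : Fin n, X k →L[ℝ] X k) (lam : ℝ) :
    subScalar T lam k = T ⟨k, h⟩ - lam • .id ℝ (X k) :=
  dif_pos h

theorem norm_subScalar_le {n : ℕ} {T : ∀ k : Fin n, X k →L[ℝ] X k} {lam M : ℝ}
    (hT : ∀ k, ‖T k‖ ≤ M) (hlam : |lam| ≤ M) (k : ℕ) : ‖subScalar T lam k‖ ≤ 2 * M := by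
  have hM : 0 ≤ M := (abs_nonneg _).trans hlam
  rw [subScalar]
  split_ifs with h
  · calc ‖T ⟨k, h⟩ - lam • ContinuousLinearMap.id ℝ (X k)‖
        ≤ ‖T ⟨k, h⟩‖ + ‖lam • ContinuousLinearMap.id ℝ (X k)‖ := norm_sub_le _ _
      _ ≤ ‖T ⟨k, h⟩‖ + |lam| * 1 := by
          rw [norm_smul, Real.norm_eq_abs]
          gcongr
          exact ContinuousLinearMap.norm_id_le
      _ ≤ 2 * M := by linarith [hT ⟨k, h⟩]
  · simpa using hM

variable (D m ν L) in
/-- The coordinates of `λ z + i_n (((T_k - λ) z_k)_{k ≤ n}, 0)`, which differ from those of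
`T_1 ⊕ ⋯ ⊕ T_n + λ P_{(n,∞)}` at `z` only by the extension of a vector that is supported on the
finite set `Γ_n`; unlike the latter, they satisfy a bound close to that of the summands. -/
noncomputable def tightDiag {n : ℕ} (T : ∀ k : Fin n, X k →L[ℝ] X k) (lam : ℝ) :
    D.Vec →ₗ[ℝ] D.Vec :=
  lam • .id + extL D m ν L n ∘ₗ D.diagonal (subScalar T lam)

theorem norm_tightDiag_fst_le {n : ℕ} {T : ∀ k : Fin n, X k →L[ℝ] X k} {lam M : ℝ}
    (hT : ∀ k, ‖T k‖ ≤ M) (hlam : |lam| ≤ M) (z : D.Vec) (k : ℕ) :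
    ‖(tightDiag D m ν L T lam z).1 k‖ ≤ M * ‖z.1 k‖ := by
  by_cases h : k < n
  · have : (tightDiag D m ν L T lam z).1 k = T ⟨k, h⟩ (z.1 k) := by
      simp [tightDiag, ext, trunc, h, subScalar_of_lt h]
    rw [this]
    exact (T ⟨k, h⟩).le_of_opNorm_le (hT _) _
  · have : (tightDiag D m ν L T lam z).1 k = lam • z.1 k := by
      simp [tightDiag, ext, trunc, h]
    rw [this, norm_smul, Real.norm_eq_abs]
    gcongr

theorem WeaklyAdmissible.boundedBy_tightDiag (hD : D.WeaklyAdmissible m L) {n : ℕ}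
    {T : ∀ k : Fin n, X k →L[ℝ] X k} {lam M R : ℝ} (hT : ∀ k, ‖T k‖ ≤ M) (hlam : |lam| ≤ M)
    {z : D.Vec} (hz : BoundedBy z R) :
    BoundedBy (tightDiag D m ν L T lam z) ((1 + 2 / m (sInf L)) * M * R) := by
  have hM : 0 ≤ M := (abs_nonneg _).trans hlam
  have hR := hz.nonneg
  refine ⟨fun k => ?_, fun γ => ?_⟩
  · calc ‖(tightDiag D m ν L T lam z).1 k‖ ≤ M * ‖z.1 k‖ := norm_tightDiag_fst_le hT hlam z k
      _ ≤ 1 * (M * R) := by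
          rw [one_mul]
          gcongr
          exact hz.1 k
      _ ≤ (1 + 2 / m (sInf L)) * M * R := by
          rw [mul_assoc]
          gcongr
          exact le_add_of_nonneg_right (by positivity)
  · set u := D.diagonal (subScalar T lam) z with hu
    have hext : |(D.ext m ν L n u).2 γ| ≤ 2 * M * R / m (sInf L) := by
      have hu1 := (boundedBy_diagonal (norm_subScalar_le hT hlam) hz).1
      have hu2 : ∀ γ ∈ D.Gam m ν L n, |u.2 γ| ≤ 0 := by simp [hu]
      refine (hD.abs_ext_le le_rfl hu1 hu2 γ).trans_eq ?_
      rw [mul_zero, max_eq_left (by positivity)]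
    calc |(tightDiag D m ν L T lam z).2 γ|
        ≤ |lam| * |z.2 γ| + |(D.ext m ν L n u).2 γ| := by
          rw [← abs_mul]
          exact abs_add_le _ _
      _ ≤ M * R + 2 * M * R / m (sInf L) := by
          gcongr
          exact hz.2 γ
      _ = (1 + 2 / m (sInf L)) * M * R := by ring

theorem WeaklyAdmissible.exists_clm_coordsL_eq_tightDiag (hD : D.WeaklyAdmissible m L) {n : ℕ}
    {T : ∀ k : Fin n, X k →L[ℝ] X k} {lam M : ℝ} (hT : ∀ k, ‖T k‖ ≤ M) (hlam : |lam| ≤ M) :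
    ∃ U : D.space m ν L →L[ℝ] D.space m ν L,
      (∀ z, coordsL D m ν L (U z) = tightDiag D m ν L T lam (coordsL D m ν L z)) ∧
      ‖U‖ ≤ (1 + 2 / m (sInf L)) * M := by
  have hM : 0 ≤ M := (abs_nonneg _).trans hlam
  obtain ⟨J, hJ⟩ := hD.exists_clm_coordsL_eq_ext (ν := ν) n (D.diagonal (subScalar T lam))
    fun z => boundedBy_diagonal (norm_subScalar_le hT hlam) (boundedBy_coordsL z)
  let U : D.space m ν L →L[ℝ] D.space m ν L := lam • .id ℝ _ + J
  have hU (z : D.space m ν L) :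
      coordsL D m ν L (U z) = tightDiag D m ν L T lam (coordsL D m ν L z) := by
    have hUz : U z = lam • z + J z := rfl
    rw [hUz, map_add, map_smul, hJ]
    rfl
  refine ⟨U, hU, U.opNorm_le_bound (by positivity) fun z => norm_le_of_boundedBy_coordsL ?_⟩
  rw [hU]
  exact hD.boundedBy_tightDiag hT hlam (boundedBy_coordsL z)

theorem exists_diag_sub_tightDiag_eq_ext {n : ℕ} (T : ∀ k : Fin n, X k →L[ℝ] X k) (lam : ℝ)
    (z : D.Vec) : ∃ u : D.Vec, trunc n u.1 = 0 ∧
      D.diag m ν L n T lam z - tightDiag D m ν L T lam z = D.ext m ν L n u := by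
  set y : Fin n → D.Vec := fun k => D.ext m ν L (k + 1) (Pi.single (k : ℕ) (T k (z.1 k)), 0)
  have hy1 (k : Fin n) : (y k).1 = Pi.single (k : ℕ) (T k (z.1 k)) :=
    trunc_single (Nat.lt_succ_self _) _
  have hy (k : Fin n) : extL D m ν L n (y k) = y k := ext_ext (Nat.succ_le_of_lt k.2) _
  refine ⟨∑ k, y k - lam • z - D.diagonal (subScalar T lam) z, ?_, ?_⟩
  · funext i
    rw [trunc]
    split_ifs with hi
    swap
    · rfl
    have hsum : (∑ k, y k).1 i = T ⟨i, hi⟩ (z.1 i) := by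
      rw [Prod.fst_sum, Finset.sum_apply, Finset.sum_eq_single ⟨i, hi⟩]
      · simp [hy1]
      · intro k _ hk
        have : i ≠ k := fun h => hk (Fin.ext h.symm)
        simp [hy1, this]
      · simp
    simp [hsum, subScalar_of_lt hi]
  · have hdiag : D.diag m ν L n T lam z = ∑ k, y k + lam • (z - extL D m ν L n z) := rfl
    have htight : tightDiag D m ν L T lam z =
        lam • z + extL D m ν L n (D.diagonal (subScalar T lam) z) := rfl
    rw [← extL_apply, map_sub, map_sub, map_sum, map_smul, Finset.sum_congr rfl fun k _ => hy k,
      hdiag, htight, smul_sub]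
    abel

theorem finiteDimensional_range_of_forall_exists_ext {E : Type*} [AddCommGroup E] [Module ℝ E]
    {n : ℕ} (K : E →ₗ[ℝ] D.space m ν L)
    (hK : ∀ x, ∃ u : D.Vec, trunc n u.1 = 0 ∧ coordsL D m ν L (K x) = D.ext m ν L n u) :
    FiniteDimensional ℝ (LinearMap.range K) := by
  have := (finite_gam (D := D) (m := m) (ν := ν) (L := L) n).to_subtype
  let restrictGam : D.Vec →ₗ[ℝ] D.Gam m ν L n → ℝ :=
    LinearMap.funLeft ℝ ℝ Subtype.val ∘ₗ LinearMap.snd ℝ _ _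
  refine FiniteDimensional.of_injective
    (restrictGam ∘ₗ coordsL D m ν L ∘ₗ (LinearMap.range K).subtype)
    ((injective_iff_map_eq_zero _).2 ?_)
  rintro ⟨_, x, rfl⟩ hx
  obtain ⟨u, hu1, hu⟩ := hK x
  have hu2 : ∀ γ ∈ D.Gam m ν L n, u.2 γ = 0 := fun γ hγ => by
    have h : (coordsL D m ν L (K x)).2 γ = 0 := congrFun hx ⟨γ, hγ⟩
    rwa [hu, ext_of_mem_gam _ hγ] at h
  refine Subtype.ext (coordsL_injective ?_)
  rw [hu, ext_eq_zero hu1 hu2]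
  exact (map_zero (coordsL D m ν L)).symm

end AHChoices

theorem mainTheorem10_general {X : ℕ → Type*} [∀ k, NormedAddCommGroup (X k)]
    [∀ k, NormedSpace ℝ (X k)] {m ν : ℕ → ℕ} {L : Set ℕ} {D : AHChoices X}
    (hD : D.WeaklyAdmissible m L) (n : ℕ) (T : ∀ k : Fin n, X k →L[ℝ] X k) (lam : ℝ) :
    ∃ S : D.space m ν L →L[ℝ] D.space m ν L,
      (∀ z : D.space m ν L,
        D.coords m ν L (S z) = D.diag m ν L n T lam (D.coords m ν L z)) ∧
      ∃ K : D.space m ν L →L[ℝ] D.space m ν L,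
        IsCompactOperator K ∧
        FiniteDimensional ℝ (LinearMap.range (K : D.space m ν L →ₗ[ℝ] D.space m ν L)) ∧
        ‖S - K‖ ≤ (1 + 2 / (m (sInf L) : ℝ)) *
          max (((Finset.univ.sup fun k => ‖T k‖₊ : ℝ≥0) : ℝ)) |lam| := by
  have hT (k : Fin n) : ‖T k‖ ≤ max ((Finset.univ.sup fun k => ‖T k‖₊ : ℝ≥0) : ℝ) |lam| :=
    le_max_of_le_left
      (NNReal.coe_le_coe.2 (Finset.le_sup (f := fun k => ‖T k‖₊) (Finset.mem_univ k)))
  obtain ⟨S, hS⟩ := hD.exists_clm_coords_eq_diag (ν := ν) n T lam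
  obtain ⟨U, hU, hU_norm⟩ := hD.exists_clm_coordsL_eq_tightDiag (ν := ν) hT (le_max_right _ _)
  have hfin : FiniteDimensional ℝ
      (LinearMap.range ((S - U : D.space m ν L →L[ℝ] D.space m ν L) :
        D.space m ν L →ₗ[ℝ] D.space m ν L)) := by
    refine AHChoices.finiteDimensional_range_of_forall_exists_ext (n := n) _ fun z => ?_
    obtain ⟨u, hu1, hu⟩ := AHChoices.exists_diag_sub_tightDiag_eq_ext (D := D) (m := m) (ν := ν)
      (L := L) T lam (AHChoices.coordsL D m ν L z)
    refine ⟨u, hu1, Eq.trans ?_ hu⟩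
    rw [← hU, AHChoices.coordsL_apply z, ← hS]
    exact map_sub (AHChoices.coordsL D m ν L) (S z) (U z)
  exact ⟨S, hS, S - U, isCompactOperator_of_finiteDimensional_range _, hfin,
    (congrArg norm (sub_sub_cancel S U)).trans_le hU_norm⟩

theorem mainTheorem10 {X : ℕ → Type*} [∀ k, NormedAddCommGroup (X k)]
    [∀ k, NormedSpace ℝ (X k)] [∀ k, CompleteSpace (X k)]
    [∀ k, TopologicalSpace.SeparableSpace (X k)]
    (m ν : ℕ → ℕ) (hmν : AHLacunary m ν)
    (L : Set ℕ) (hL : L.Infinite) (hL1 : ∀ j ∈ L, 1 ≤ j)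
    (D : AHChoices X) (hD : D.Admissible m ν L)
    (n : ℕ) (T : ∀ k : Fin n, X k →L[ℝ] X k) (lam : ℝ) :
    ∃ S : D.space m ν L →L[ℝ] D.space m ν L,
      (∀ z : D.space m ν L,
        D.coords m ν L (S z) = D.diag m ν L n T lam (D.coords m ν L z)) ∧
      ∃ K : D.space m ν L →L[ℝ] D.space m ν L,
        IsCompactOperator K ∧
        FiniteDimensional ℝ (LinearMap.range (K : D.space m ν L →ₗ[ℝ] D.space m ν L)) ∧
        ‖S - K‖ ≤ (1 + 4 / ((m (sInf L) : ℝ) - 2)) *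
          max (((Finset.univ.sup fun k => ‖T k‖₊ : ℝ≥0) : ℝ)) |lam| := by
  obtain ⟨S, hS, K, hK, hK_fin, hSK⟩ :=
    mainTheorem10_general (ν := ν) (hD.weaklyAdmissible hmν hL hL1) n T lam
  refine ⟨S, hS, K, hK, hK_fin, hSK.trans ?_⟩
  have hm : (2 : ℝ) < m (sInf L) := by
    exact_mod_cast (hD.weaklyAdmissible hmν hL hL1).two_lt
  gcongr (1 + ?_) * _
  exact div_le_div₀ (by norm_num) (by norm_num) (by linarith) (by linarith)
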